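/- Let $\mathcal X$ be a set with a symmetric neighbor relation $\mathcal N\subseteq\mathcal X^2$ and let $\mathcal Z$ be a measurable space. A mechanism assigns to each $x\in\mathcal X$ a probability distribution $A(\cdot|x)$ of its output; it is $(\varepsilon,\delta)$-differentially private if $A(S|x)\le e^{\varepsilon}A(S|x')+\delta$ for all $(x,x')\in\mathcal N$ and all measurable sets $S$ of outputs. Let $P_{Z|X}$ be a mechanism with outputs in $\mathcal Z$, and let $Q$ be a probability distribution on $\mathcal Z$ with $P_{Z|X}(\cdot|x)\ll Q$ for every $x\in\mathcal X$. The Poisson private representation (PPR) of $P_{Z|X}$ with parameter $\alpha\in(1,\infty)$ and proposal distribution $Q$ is the following mechanism. Let $Z_1,Z_2,\ldots$ be i.i.d. with law $Q$, and, independently of them, let $T_1<T_2<\cdots$ be a Poisson process of rate $1$ on $[0,\infty)$, i.e. $T_1,T_2-T_1,T_3-T_2,\ldots$ are i.i.d. $\mathrm{Exp}(1)$. Given $x$, put $P:=P_{Z|X}(\cdot|x)$ and $\tilde T_i:=T_i\cdot\bigl(\frac{\mathrm dP}{\mathrm dQ}(Z_i)\bigr)^{-1}$, with $\tilde T_i:=\infty$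 if $\frac{\mathrm dP}{\mathrm dQ}(Z_i)=0$. Conditionally on $(Z_i,T_i)_i$, draw $K\in\{1,2,\ldots\}$ with $$\Pr\bigl(K=k\,\big|\,(Z_i,T_i)_i\bigr)=\frac{\tilde T_k^{-\alpha}}{\sum_{i=1}^\infty\tilde T_i^{-\alpha}} .$$ The output of PPR is $((Z_i)_{i\ge1},K)$; write $P_{(Z_i)_i,K|X}$ for its conditional distribution given $x$. **Theorem.** Let $\varepsilon\ge0$, $\delta\ge0$ and $1<\alpha<\infty$. If $P_{Z|X}$ is $(\varepsilon,\delta)$-differentially private, then the PPR mechanism $P_{(Z_i)_i,K|X}$ with parameter $\alpha$ and proposal distribution $Q$ is $(2\alpha\varepsilon,\,2\delta)$-differentially private (with respect to the same neighbor relation $\mathcal N$). -/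

import Mathlib

open MeasureTheory ProbabilityTheory
open scoped ENNReal

noncomputable section

namespace PPR

/-- `(ε, δ)`-differential privacy of a mechanism `A` (which maps the data `x` to the law `A x` of
its output) with respect to the neighbor relation `N`. -/
def IsDP {𝒳 𝒴 : Type*} [MeasurableSpace 𝒴] (N : 𝒳 → 𝒳 → Prop) (A : 𝒳 → Measure 𝒴)
    (ε δ : ℝ) : Prop :=
  ∀ x x' : 𝒳, N x x' → ∀ S : Set 𝒴, MeasurableSet S →
    A x S ≤ ENNReal.ofReal (Real.exp ε) * A x' S + ENNReal.ofReal δ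

instance isProbabilityMeasure_exp_one : IsProbabilityMeasure (expMeasure 1) :=
  isProbabilityMeasure_expMeasure one_pos

section Encoder

variable {𝒵 : Type*} [MeasurableSpace 𝒵]

/-- The joint law of the i.i.d. samples `Z i ∼ Q` and of the i.i.d. `Exp(1)` interarrival times,
which are independent of the samples. Sequences are indexed from `0`. -/
def randomnessLaw (Q : Measure 𝒵) [IsProbabilityMeasure Q] :
    Measure ((ℕ → 𝒵) × (ℕ → ℝ)) :=
  (Measure.infinitePi fun _ : ℕ => Q).prod (Measure.infinitePi fun _ : ℕ => expMeasure 1)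

instance (Q : Measure 𝒵) [IsProbabilityMeasure Q] : IsProbabilityMeasure (randomnessLaw Q) := by
  unfold randomnessLaw; infer_instance

/-- The points `T i` of the rate one Poisson process with interarrival times `e`. -/
def arrivalTime (e : ℕ → ℝ) (i : ℕ) : ℝ := ∑ j ∈ Finset.range (i + 1), e j

/-- `T̃ i = T i * (dP/dQ (Z i))⁻¹`, which is `∞` if `dP/dQ (Z i) = 0`. -/
def scaledTime (Q P : Measure 𝒵) (ω : (ℕ → 𝒵) × (ℕ → ℝ)) (i : ℕ) : ℝ≥0∞ :=
  open scoped Classical in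
  if P.rnDeriv Q (ω.1 i) = 0 then ∞
  else ENNReal.ofReal (arrivalTime ω.2 i) * (P.rnDeriv Q (ω.1 i))⁻¹

/-- The unnormalized weight `T̃ i ^ (-α)` of the index `i` (it is `0` if `T̃ i = ∞`). -/
def weight (α : ℝ) (Q P : Measure 𝒵) (ω : (ℕ → 𝒵) × (ℕ → ℝ)) (i : ℕ) : ℝ≥0∞ :=
  scaledTime Q P ω i ^ (-α)

/-- The normalization `∑ i, T̃ i ^ (-α)`. -/
def totalWeight (α : ℝ) (Q P : Measure 𝒵) (ω : (ℕ → 𝒵) × (ℕ → ℝ)) : ℝ≥0∞ :=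
  ∑' i, weight α Q P ω i

lemma measurable_weight (α : ℝ) (Q P : Measure 𝒵) (i : ℕ) :
    Measurable fun ω => weight α Q P ω i := by
  have h1 : Measurable fun ω : (ℕ → 𝒵) × (ℕ → ℝ) => P.rnDeriv Q (ω.1 i) :=
    (Measure.measurable_rnDeriv P Q).comp ((measurable_pi_apply i).comp measurable_fst)
  have h2 : Measurable fun ω : (ℕ → 𝒵) × (ℕ → ℝ) => arrivalTime ω.2 i := by
    unfold arrivalTime
    exact Finset.measurable_sum _ fun j _ => (measurable_pi_apply j).comp measurable_snd
  have h3 : Measurable fun ω : (ℕ → 𝒵) × (ℕ → ℝ) => scaledTime Q P ω i := by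
    unfold scaledTime
    exact Measurable.ite (h1 (measurableSet_singleton 0)) measurable_const
      (h2.ennreal_ofReal.mul h1.inv)
  exact h3.pow_const _

lemma measurable_totalWeight (α : ℝ) (Q P : Measure 𝒵) :
    Measurable fun ω => totalWeight α Q P ω :=
  Measurable.ennreal_tsum fun i => measurable_weight α Q P i

/-- The conditional law of the index `K` chosen by the encoder given `(Z i, T i)`:
`K = k` has probability `T̃ k ^ (-α) / ∑ i, T̃ i ^ (-α)`. (For `α > 1` and `P ≪ Q` the sum is almost
surely positive and finite; on the null event where it is not, `K` is the first index.) -/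
def indexLaw (α : ℝ) (Q P : Measure 𝒵) (ω : (ℕ → 𝒵) × (ℕ → ℝ)) : Measure ℕ :=
  open scoped Classical in
  if totalWeight α Q P ω = 0 ∨ totalWeight α Q P ω = ∞ then Measure.dirac 0
  else Measure.sum fun k => (weight α Q P ω k / totalWeight α Q P ω) • Measure.dirac k

lemma measurable_indexLaw (α : ℝ) (Q P : Measure 𝒵) : Measurable (indexLaw α Q P) := by
  have ht := measurable_totalWeight α Q P
  unfold indexLaw
  refine Measurable.ite ((ht (measurableSet_singleton 0)).union
    (ht (measurableSet_singleton ∞))) measurable_const ?_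
  refine Measure.measurable_of_measurable_coe _ fun s hs => ?_
  simp only [Measure.sum_apply _ hs, Measure.smul_apply, smul_eq_mul]
  exact Measurable.ennreal_tsum fun k => ((measurable_weight α Q P k).div ht).mul_const _

/-- The encoder as a Markov kernel from the values of `(Z, T)` to the index `K`. -/
def indexKernel (α : ℝ) (Q P : Measure 𝒵) : Kernel ((ℕ → 𝒵) × (ℕ → ℝ)) ℕ where
  toFun := indexLaw α Q P
  measurable' := measurable_indexLaw α Q P

instance (α : ℝ) (Q P : Measure 𝒵) : IsMarkovKernel (indexKernel α Q P) := by
  refine ⟨fun ω => ?_⟩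
  change IsProbabilityMeasure (indexLaw α Q P ω)
  unfold indexLaw
  split_ifs with h
  · infer_instance
  · push Not at h
    refine ⟨?_⟩
    simp only [Measure.sum_apply _ MeasurableSet.univ, Measure.smul_apply, smul_eq_mul,
      measure_univ, mul_one, div_eq_mul_inv, ENNReal.tsum_mul_right]
    exact ENNReal.mul_inv_cancel h.1 h.2

/-- The law of `((Z i)_i, K)` when the encoder simulates the distribution `P` with parameter `α`
and proposal distribution `Q`. -/
def pprLaw (α : ℝ) (Q P : Measure 𝒵) [IsProbabilityMeasure Q] : Measure ((ℕ → 𝒵) × ℕ) :=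
  (randomnessLaw Q ⊗ₘ indexKernel α Q P).map fun p => (p.1.1, p.2)

instance (α : ℝ) (Q P : Measure 𝒵) [IsProbabilityMeasure Q] :
    IsProbabilityMeasure (pprLaw α Q P) :=
  Measure.isProbabilityMeasure_map (by fun_prop)

end Encoder

end PPR

end

/-! Let `f`, `f'` be the densities of the two output laws with respect to `Q`, let `c = e^ε`, and
let `h` be `f` clamped to the interval `[c⁻¹ f', c f']`. The proof passes from `f` to `f'` through
`h`.

From `h` to `f'`: they agree pointwise up to a factor `c`, so the numerator and the denominator of a
choice probability each change by at most `c ^ α` (`choiceProb_le`). Together this is `e^(2αε)`. The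
clamp `h` need not have mass one; the choice rule normalizes anyway.

From `f` to `h`: the `L¹` distance is at most `∫ (f - c f')⁺ + ∫ (f' - c f)⁺`, and privacy in both
directions bounds each term by `δ` (`lintegral_rnDeriv_sub_le`). An `L¹` change `η` of the intensity
costs at most `η` in the law of the choice, whatever `α` is (`lintegral_choiceProb_le_add`). To see
this, put `m = min f h` and `g = max f h`. The share of point `k` when it has intensity `m` and all
others have `g` lies below its choice probability under `f` and under `h`. Mecke's formula and a
rescaling of time give the expected sum of these shares as `(∫ m) * C` with `C` depending only on
`g` (`lintegral_tsum_overlapProb`). Taking `m = g` shows `(∫ g) * C = 1`, so the overlap is `∫ m / ∫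
g ≥ 1 - η`, as `∫ g ≥ ∫ f = 1`. -/

namespace PPR

/-! ### Inserting one coordinate into an i.i.d. sequence. -/

section InsertAt

variable {β : Type*}

/-- Insert `a` at position `k` into a sequence. -/
def insertAt (k : ℕ) (a : β) (x : ℕ → β) (i : ℕ) : β :=
  if i < k then x i else if i = k then a else x (i - 1)

/-- The increasing enumeration of the natural numbers other than `k`. -/
def skipAt (k i : ℕ) : ℕ := if i < k then i else i + 1

@[simp] lemma insertAt_self (k : ℕ) (a : β) (x : ℕ → β) : insertAt k a x k = a := by
  simp [insertAt]

@[simp] lemma insertAt_skipAt (k : ℕ) (a : β) (x : ℕ → β) (i : ℕ) :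
    insertAt k a x (skipAt k i) = x i := by
  unfold insertAt skipAt
  split_ifs <;> first | rfl | omega

lemma insertAt_of_lt {k i : ℕ} (h : i < k) (a : β) (x : ℕ → β) : insertAt k a x i = x i := by
  simp [insertAt, h]

lemma skipAt_injective (k : ℕ) : Function.Injective (skipAt k) := by
  intro i j h
  unfold skipAt at h
  split_ifs at h <;> omega

lemma skipAt_ne (k i : ℕ) : skipAt k i ≠ k := by
  unfold skipAt; split_ifs <;> omega

lemma exists_skipAt {k i : ℕ} (h : i ≠ k) : ∃ j, skipAt k j = i := by
  rcases lt_or_gt_of_ne h with h | h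
  · exact ⟨i, by simp [skipAt, h]⟩
  · exact ⟨i - 1, by unfold skipAt; split_ifs <;> omega⟩

lemma tsum_eq_add_tsum_skipAt (x : ℕ → ℝ≥0∞) (k : ℕ) :
    ∑' i, x i = x k + ∑' i, x (skipAt k i) := by
  rw [ENNReal.tsum_eq_add_tsum_ite k, ← (skipAt_injective k).tsum_eq]
  · simp [skipAt_ne]
  · intro i hi
    refine exists_skipAt fun h => ?_
    simp [h] at hi

variable [MeasurableSpace β]

lemma measurable_insertAt (k : ℕ) : Measurable fun p : β × (ℕ → β) => insertAt k p.1 p.2 := by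
  refine measurable_pi_lambda _ fun i => ?_
  unfold insertAt
  split_ifs <;> fun_prop

/-- It suffices to test on finite boxes. The preimage of a box is a box with the `k`-th side moved
to the separate coordinate, so the product of measures is merely reordered. -/
lemma map_insertAt_infinitePi (Q : Measure β) [IsProbabilityMeasure Q] (k : ℕ) :
    (Q.prod (Measure.infinitePi fun _ : ℕ => Q)).map (fun p => insertAt k p.1 p.2) =
      Measure.infinitePi fun _ : ℕ => Q := by
  classical
  refine Measure.eq_infinitePi _ fun s t ht => ?_
  rw [Measure.map_apply (measurable_insertAt k) (.pi s.countable_toSet fun _ _ => ht _)]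
  set s' : Finset ℕ := s.preimage (skipAt k) (skipAt_injective k).injOn with hs'
  have hpre : (fun p : β × (ℕ → β) => insertAt k p.1 p.2) ⁻¹' ((s : Set ℕ).pi t) =
      (if k ∈ s then t k else Set.univ) ×ˢ ((s' : Set ℕ).pi fun i => t (skipAt k i)) := by
    ext ⟨a, x⟩
    simp only [Set.mem_preimage, Set.mem_pi, Finset.mem_coe, Set.mem_prod, hs',
      Finset.mem_preimage]
    constructor
    · intro h
      refine ⟨?_, fun i hi => by simpa using h _ hi⟩
      split_ifs with hk
      · simpa using h k hk
      · trivial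
    · rintro ⟨h1, h2⟩ i hi
      by_cases hik : i = k
      · subst hik
        simpa [hi] using h1
      · obtain ⟨j, rfl⟩ := exists_skipAt hik
        simpa using h2 j hi
  rw [hpre, Measure.prod_prod, Measure.infinitePi_pi _ fun i _ => ht _]
  have himg : s'.image (skipAt k) = s.erase k := by
    ext i
    simp only [Finset.mem_image, hs', Finset.mem_preimage, Finset.mem_erase]
    constructor
    · rintro ⟨j, hj, rfl⟩
      exact ⟨skipAt_ne k j, hj⟩
    · rintro ⟨h1, h2⟩
      obtain ⟨j, rfl⟩ := exists_skipAt h1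
      exact ⟨j, h2, rfl⟩
  have hprod : ∏ i ∈ s', Q (t (skipAt k i)) = ∏ i ∈ s.erase k, Q (t i) := by
    rw [← himg, Finset.prod_image (skipAt_injective k).injOn]
  rw [hprod]
  split_ifs with hk
  · exact Finset.mul_prod_erase s (fun i => Q (t i)) hk
  · simp [Finset.erase_eq_of_notMem hk]

lemma lintegral_infinitePi_eq_insertAt (Q : Measure β) [IsProbabilityMeasure Q] (k : ℕ)
    {F : (ℕ → β) → ℝ≥0∞} (hF : Measurable F) :
    ∫⁻ x, F x ∂(Measure.infinitePi fun _ : ℕ => Q) =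
      ∫⁻ a, ∫⁻ x, F (insertAt k a x) ∂(Measure.infinitePi fun _ : ℕ => Q) ∂Q := by
  conv_lhs => rw [← map_insertAt_infinitePi Q k]
  rw [lintegral_map hF (measurable_insertAt k),
    lintegral_prod (fun p : β × (ℕ → β) => F (insertAt k p.1 p.2))
      (hF.comp (measurable_insertAt k)).aemeasurable]

/-- Second Borel–Cantelli lemma. It serves twice: for the divergence of the arrival times and for
the positivity of the total weight. -/
lemma ae_frequently_mem_infinitePi (Q : Measure β) [IsProbabilityMeasure Q] {s : Set β}
    (hs : MeasurableSet s) (h0 : Q s ≠ 0) :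
    ∀ᵐ x ∂(Measure.infinitePi fun _ : ℕ => Q), ∃ᶠ i in Filter.atTop, x i ∈ s := by
  have hind : iIndepSet (fun (i : ℕ) => {x : ℕ → β | x i ∈ s})
      (Measure.infinitePi fun _ : ℕ => Q) := by
    have h1 : iIndepFun (fun (i : ℕ) (x : ℕ → β) => x i) (Measure.infinitePi fun _ : ℕ => Q) :=
      iIndepFun_infinitePi (X := fun (_ : ℕ) (b : β) => b) fun _ => measurable_id
    refine (iIndepSet_iff_meas_biInter fun i => (measurable_pi_apply i) hs).2 fun t => ?_
    exact h1.measure_inter_preimage_eq_mul t (sets := fun _ => s) fun _ _ => hs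
  have hmeas (i : ℕ) : Measure.infinitePi (fun _ : ℕ => Q) {x : ℕ → β | x i ∈ s} = Q s :=
    (measurePreserving_eval_infinitePi (fun _ : ℕ => Q) i).measure_preimage hs.nullMeasurableSet
  have h := measure_limsup_eq_one (fun i => (measurable_pi_apply i) hs) hind (by
    refine (tsum_congr hmeas).trans ?_
    exact ENNReal.tsum_const_eq_top_of_ne_zero h0)
  have hm : MeasurableSet (Filter.limsup (fun (i : ℕ) => {x : ℕ → β | x i ∈ s}) Filter.atTop) :=
    MeasurableSet.measurableSet_limsup fun i => (measurable_pi_apply i) hs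
  have h2 : ∀ᵐ x ∂(Measure.infinitePi fun _ : ℕ => Q),
      x ∈ Filter.limsup (fun (i : ℕ) => {x : ℕ → β | x i ∈ s}) Filter.atTop :=
    (mem_ae_iff_prob_eq_one hm).2 h
  filter_upwards [h2] with x hx
  exact Filter.mem_limsup_iff_frequently_mem.1 hx

end InsertAt

/-! ### Splitting an exponential gap. -/

section Exponential

lemma expMeasure_one_eq : expMeasure 1 = volume.withDensity (exponentialPDF 1) := rfl

lemma measurable_exponentialPDF_one : Measurable (exponentialPDF 1) :=
  (measurable_exponentialPDFReal 1).ennreal_ofReal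

lemma ae_pos_expMeasure_one : ∀ᵐ x ∂expMeasure 1, 0 < x := by
  rw [expMeasure_one_eq, ae_withDensity_iff measurable_exponentialPDF_one]
  have h : ∀ᵐ x : ℝ, x ≠ 0 := by simp [ae_iff]
  filter_upwards [h] with x hx hx'
  by_contra hlt
  exact hx' (exponentialPDF_of_neg (lt_of_le_of_ne (not_lt.1 hlt) hx))

/-- Since `e^(-u) e^(-(s-u)) = e^(-s)`, the joint density of two gaps depends only on their sum:
given the sum, the split point has constant density. -/
lemma exponentialPDF_mul_sub (u s : ℝ) :
    exponentialPDF 1 u * exponentialPDF 1 (s - u) =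
      exponentialPDF 1 s * (Set.Icc 0 s).indicator 1 u := by
  by_cases hu : 0 ≤ u
  · by_cases hs : u ≤ s
    · rw [exponentialPDF_of_nonneg hu, exponentialPDF_of_nonneg (sub_nonneg.2 hs),
        exponentialPDF_of_nonneg (hu.trans hs), ← ENNReal.ofReal_mul (by positivity),
        Set.indicator_of_mem (Set.mem_Icc.2 ⟨hu, hs⟩)]
      simp only [Pi.one_apply, mul_one, one_mul, ← Real.exp_add]
      ring_nf
    · rw [exponentialPDF_of_neg (by linarith : s - u < 0), Set.indicator_of_notMem fun h => hs h.2]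
      simp
  · rw [exponentialPDF_of_neg (not_le.1 hu), Set.indicator_of_notMem fun h => hu h.1]
    simp

/-- Change of variables `s = u + v`, followed by Tonelli. The right side integrates `u` against
Lebesgue measure, not a uniform law, which is the intensity wanted in Mecke's formula. -/
lemma lintegral_expMeasure_expMeasure {g : ℝ → ℝ → ℝ≥0∞} (hg : Measurable (Function.uncurry g)) :
    ∫⁻ u, ∫⁻ v, g u v ∂expMeasure 1 ∂expMeasure 1 =
      ∫⁻ s, (∫⁻ u in Set.Ioc 0 s, g u (s - u)) ∂expMeasure 1 := by
  have hp := measurable_exponentialPDF_one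
  have hg1 (u : ℝ) : Measurable (g u) := hg.comp (by fun_prop : Measurable fun v => (u, v))
  have hg2 : Measurable fun p : ℝ × ℝ => g p.1 p.2 := hg
  have hg3 : Measurable fun p : ℝ × ℝ => g p.1 (p.2 - p.1) :=
    hg.comp (by fun_prop : Measurable fun p : ℝ × ℝ => (p.1, p.2 - p.1))
  have hL : ∫⁻ u, ∫⁻ v, g u v ∂expMeasure 1 ∂expMeasure 1 =
      ∫⁻ u, ∫⁻ s, exponentialPDF 1 u * exponentialPDF 1 (s - u) * g u (s - u) := by
    rw [expMeasure_one_eq, lintegral_withDensity_eq_lintegral_mul _ hp]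
    · refine lintegral_congr fun u => ?_
      rw [Pi.mul_apply, lintegral_withDensity_eq_lintegral_mul _ hp (hg1 u),
        ← lintegral_const_mul _ (hp.mul (hg1 u)), ← lintegral_sub_right_eq_self _ u]
      simp [mul_assoc]
    · exact hg2.lintegral_prod_right'
  rw [hL, lintegral_lintegral_swap]
  · have hR (s : ℝ) : ∫⁻ u in Set.Ioc 0 s, g u (s - u) =
        ∫⁻ u, (Set.Icc 0 s).indicator 1 u * g u (s - u) := by
      rw [setLIntegral_congr Ioc_ae_eq_Icc, ← lintegral_indicator measurableSet_Icc]
      refine lintegral_congr fun u => ?_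
      simp only [Set.indicator]
      split_ifs <;> simp
    simp_rw [hR]
    have hind : Measurable fun p : ℝ × ℝ => (Set.Icc 0 p.1).indicator (1 : ℝ → ℝ≥0∞) p.2 := by
      have : MeasurableSet {p : ℝ × ℝ | 0 ≤ p.2 ∧ p.2 ≤ p.1} :=
        (measurableSet_le measurable_const measurable_snd).inter
          (measurableSet_le measurable_snd measurable_fst)
      exact (measurable_one.indicator this)
    have hm : Measurable fun p : ℝ × ℝ =>
        (Set.Icc 0 p.1).indicator (1 : ℝ → ℝ≥0∞) p.2 * g p.2 (p.1 - p.2) :=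
      hind.mul (hg3.comp measurable_swap)
    rw [expMeasure_one_eq, lintegral_withDensity_eq_lintegral_mul _ hp hm.lintegral_prod_right']
    refine lintegral_congr fun s => ?_
    have hms : Measurable fun u => (Set.Icc 0 s).indicator (1 : ℝ → ℝ≥0∞) u * g u (s - u) :=
      hm.comp (by fun_prop : Measurable fun u : ℝ => (s, u))
    rw [Pi.mul_apply, ← lintegral_const_mul _ hms]
    refine lintegral_congr fun u => ?_
    rw [exponentialPDF_mul_sub, mul_assoc]
  · refine Measurable.aemeasurable ?_
    exact ((hp.comp measurable_fst).mul (hp.comp (measurable_snd.sub measurable_fst))).mul hg3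

/-- Split the interval of length `e k` into intervals of lengths `u` and `e k - u`. -/
noncomputable def splitAt (k : ℕ) (u : ℝ) (e : ℕ → ℝ) : ℕ → ℝ :=
  insertAt k u (Function.update e k (e k - u))

lemma splitAt_insertAt (k : ℕ) (u s : ℝ) (e : ℕ → ℝ) :
    splitAt k u (insertAt k s e) = insertAt k u (insertAt k (s - u) e) := by
  unfold splitAt
  congr 1
  ext i
  by_cases h : i = k
  · subst h; simp
  · simp [insertAt, h]

lemma measurable_splitAt (k : ℕ) : Measurable fun p : (ℕ → ℝ) × ℝ => splitAt k p.2 p.1 := by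
  refine measurable_pi_lambda _ fun i => ?_
  unfold splitAt insertAt
  simp only [Function.update_apply]
  split_ifs <;> fun_prop

lemma measurableSet_Ioc_apply (k : ℕ) :
    MeasurableSet {p : (ℕ → ℝ) × ℝ | 0 < p.2 ∧ p.2 ≤ p.1 k} :=
  (measurableSet_lt measurable_const measurable_snd).inter
    (measurableSet_le measurable_snd (by fun_prop))

lemma measurable_setLIntegral_Ioc_apply (k : ℕ) {G : (ℕ → ℝ) × ℝ → ℝ≥0∞} (hG : Measurable G) :
    Measurable fun e : ℕ → ℝ => ∫⁻ u in Set.Ioc 0 (e k), G (e, u) := by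
  have h : (fun e : ℕ → ℝ => ∫⁻ u in Set.Ioc 0 (e k), G (e, u)) = fun e : ℕ → ℝ =>
      ∫⁻ u, {p : (ℕ → ℝ) × ℝ | 0 < p.2 ∧ p.2 ≤ p.1 k}.indicator G (e, u) := by
    funext e
    rw [← lintegral_indicator measurableSet_Ioc]
    rfl
  rw [h]
  exact (hG.indicator (measurableSet_Ioc_apply k)).lintegral_prod_right'

/-- The two-gap identity applied to gaps `k` and `k + 1`: deleting arrival `k` merges them into a
single exponential gap, and the deleted arrival is then distributed by Lebesgue measure over that
gap. -/
lemma lintegral_infinitePi_expMeasure_eq_splitAt (k : ℕ) {F : (ℕ → ℝ) → ℝ≥0∞}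
    (hF : Measurable F) :
    ∫⁻ e, F e ∂(Measure.infinitePi fun _ : ℕ => expMeasure 1) =
      ∫⁻ e, (∫⁻ u in Set.Ioc 0 (e k), F (splitAt k u e))
        ∂(Measure.infinitePi fun _ : ℕ => expMeasure 1) := by
  have hins (u : ℝ) : Measurable fun x : ℕ → ℝ => insertAt k u x :=
    (measurable_insertAt k).comp (by fun_prop : Measurable fun x : ℕ → ℝ => (u, x))
  have h3 : Measurable fun p : (ℝ × ℝ) × (ℕ → ℝ) =>
      insertAt k p.1.1 (insertAt k p.1.2 p.2) :=
    (measurable_insertAt k).comp ((measurable_fst.comp measurable_fst).prodMk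
      ((measurable_insertAt k).comp
        ((measurable_snd.comp measurable_fst).prodMk measurable_snd)))
  rw [lintegral_infinitePi_eq_insertAt _ k hF,
    lintegral_infinitePi_eq_insertAt _ k (F := fun e => ∫⁻ u in Set.Ioc 0 (e k), F (splitAt k u e))
      (measurable_setLIntegral_Ioc_apply k (hF.comp (measurable_splitAt k)))]
  have h1 (u : ℝ) : ∫⁻ x, F (insertAt k u x) ∂(Measure.infinitePi fun _ : ℕ => expMeasure 1) =
      ∫⁻ v, ∫⁻ x, F (insertAt k u (insertAt k v x))
        ∂(Measure.infinitePi fun _ : ℕ => expMeasure 1) ∂expMeasure 1 :=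
    lintegral_infinitePi_eq_insertAt _ k (hF.comp (hins u))
  simp_rw [h1]
  rw [lintegral_expMeasure_expMeasure
    (g := fun u v => ∫⁻ x, F (insertAt k u (insertAt k v x))
      ∂(Measure.infinitePi fun _ : ℕ => expMeasure 1)) (hF.comp h3).lintegral_prod_right']
  refine lintegral_congr fun s => ?_
  simp only [insertAt_self, splitAt_insertAt]
  rw [lintegral_lintegral_swap]
  refine Measurable.aemeasurable ?_
  exact hF.comp (h3.comp (f := fun p : ℝ × (ℕ → ℝ) => (((p.1, s - p.1) : ℝ × ℝ), p.2))
    (by fun_prop))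

end Exponential

/-! ### Arrival times of the Poisson process. -/

section Arrival

lemma arrivalTime_eq_sum_add (e : ℕ → ℝ) (k : ℕ) :
    arrivalTime e k = ∑ j ∈ Finset.range k, e j + e k := Finset.sum_range_succ _ _

lemma arrivalTime_splitAt_self (k : ℕ) (u : ℝ) (e : ℕ → ℝ) :
    arrivalTime (splitAt k u e) k = ∑ j ∈ Finset.range k, e j + u := by
  rw [arrivalTime_eq_sum_add]
  congr 1
  · refine Finset.sum_congr rfl fun j hj => ?_
    have := Finset.mem_range.1 hj
    rw [splitAt, insertAt_of_lt this, Function.update_of_ne this.ne]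
  · simp [splitAt]

lemma arrivalTime_splitAt_add (k : ℕ) (u : ℝ) (e : ℕ → ℝ) (i : ℕ) :
    arrivalTime (splitAt k u e) (k + i + 1) = arrivalTime e (k + i) := by
  induction i with
  | zero =>
    rw [arrivalTime_eq_sum_add, ← arrivalTime, add_zero, arrivalTime_splitAt_self,
      arrivalTime_eq_sum_add]
    simp [splitAt, insertAt]
  | succ i ih =>
    rw [arrivalTime_eq_sum_add, ← arrivalTime, ← add_assoc, ih,
      arrivalTime_eq_sum_add e (k + i + 1), ← arrivalTime]
    congr 1
    have h1 : ¬ k + i + 1 + 1 < k := by omega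
    have h2 : ¬ k + i + 1 + 1 = k := by omega
    have h3 : k + i + 1 ≠ k := by omega
    simp [splitAt, insertAt, h1, h2, h3]

/-- Splitting a gap adds one arrival inside it and moves no other arrival; only the indices from `k`
on shift. -/
lemma arrivalTime_splitAt_skipAt (k : ℕ) (u : ℝ) (e : ℕ → ℝ) (i : ℕ) :
    arrivalTime (splitAt k u e) (skipAt k i) = arrivalTime e i := by
  unfold skipAt
  split_ifs with h
  · refine Finset.sum_congr rfl fun j hj => ?_
    have hj' : j < k := by have := Finset.mem_range.1 hj; omega
    rw [splitAt, insertAt_of_lt hj', Function.update_of_ne hj'.ne]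
  · obtain ⟨j, rfl⟩ := Nat.exists_eq_add_of_le (not_lt.1 h)
    exact arrivalTime_splitAt_add k u e j

lemma measurable_arrivalTime (i : ℕ) : Measurable fun e : ℕ → ℝ => arrivalTime e i := by
  unfold arrivalTime; fun_prop

lemma ae_forall_pos : ∀ᵐ e ∂(Measure.infinitePi fun _ : ℕ => expMeasure 1), ∀ i, 0 < e i := by
  rw [ae_all_iff]
  intro i
  exact (measurePreserving_eval_infinitePi (fun _ : ℕ => expMeasure 1) i).quasiMeasurePreserving.ae
    ae_pos_expMeasure_one

lemma expMeasure_one_Ici_ne_zero : expMeasure 1 (Set.Ici 1) ≠ 0 := by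
  rw [expMeasure_one_eq]
  intro h
  rw [withDensity_apply_eq_zero measurable_exponentialPDF_one] at h
  have h2 : {x | exponentialPDF 1 x ≠ 0} ∩ Set.Ici 1 = Set.Ici 1 := by
    refine Set.inter_eq_right.2 fun x hx => ?_
    have hx : (1 : ℝ) ≤ x := hx
    have : (0 : ℝ) ≤ x := by linarith
    rw [Set.mem_ofPred_eq, exponentialPDF_of_nonneg this]
    simp [Real.exp_pos]
  rw [h2] at h
  simp at h

/-- A convergent sum would force the gaps to tend to `0`, but almost surely infinitely many gaps are
at least `1`. -/
lemma ae_tendsto_sum_atTop : ∀ᵐ e ∂(Measure.infinitePi fun _ : ℕ => expMeasure 1),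
    Filter.Tendsto (fun n => ∑ j ∈ Finset.range n, e j) Filter.atTop Filter.atTop := by
  filter_upwards [ae_forall_pos, ae_frequently_mem_infinitePi (expMeasure 1) measurableSet_Ici
    expMeasure_one_Ici_ne_zero] with e he hf
  by_contra h
  have hsum := (summable_iff_not_tendsto_nat_atTop_of_nonneg fun i => (he i).le).2 h
  have h1 : ∀ᶠ i in Filter.atTop, e i < 1 :=
    hsum.tendsto_atTop_zero.eventually_lt_const one_pos
  exact hf (h1.mono fun i hi hi' => absurd hi' (not_le.2 hi))

end Arrival

/-! ### Mecke's formula for the marked process. -/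

section Mecke

variable {𝒵 : Type*}

/-- The sum of `ψ` over the marked points `(Z i, T i)`. -/
noncomputable def pointSum (ψ : 𝒵 → ℝ → ℝ≥0∞) (ω : (ℕ → 𝒵) × (ℕ → ℝ)) : ℝ≥0∞ :=
  ∑' i, ψ (ω.1 i) (arrivalTime ω.2 i)

/-- The sum of `ψ` over the marked points `(Z i, T i)` with `i ≠ k`. -/
noncomputable def pointSumSkip (ψ : 𝒵 → ℝ → ℝ≥0∞) (k : ℕ) (ω : (ℕ → 𝒵) × (ℕ → ℝ)) : ℝ≥0∞ :=
  ∑' i, ψ (ω.1 (skipAt k i)) (arrivalTime ω.2 (skipAt k i))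

lemma pointSum_eq_add_pointSumSkip (ψ : 𝒵 → ℝ → ℝ≥0∞) (k : ℕ) (ω : (ℕ → 𝒵) × (ℕ → ℝ)) :
    pointSum ψ ω = ψ (ω.1 k) (arrivalTime ω.2 k) + pointSumSkip ψ k ω :=
  tsum_eq_add_tsum_skipAt (fun i => ψ (ω.1 i) (arrivalTime ω.2 i)) k

variable [MeasurableSpace 𝒵]

lemma measurable_point {ψ : 𝒵 → ℝ → ℝ≥0∞} (hψ : Measurable (Function.uncurry ψ)) (i : ℕ) :
    Measurable fun ω : (ℕ → 𝒵) × (ℕ → ℝ) => ψ (ω.1 i) (arrivalTime ω.2 i) :=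
  hψ.comp (f := fun ω : (ℕ → 𝒵) × (ℕ → ℝ) => (ω.1 i, arrivalTime ω.2 i))
    (((measurable_pi_apply i).comp measurable_fst).prodMk
      ((measurable_arrivalTime i).comp measurable_snd))

lemma measurable_pointSum {ψ : 𝒵 → ℝ → ℝ≥0∞} (hψ : Measurable (Function.uncurry ψ)) :
    Measurable (pointSum ψ) :=
  Measurable.tsum fun i => measurable_point hψ i

lemma measurable_pointSumSkip {ψ : 𝒵 → ℝ → ℝ≥0∞} (hψ : Measurable (Function.uncurry ψ))
    (k : ℕ) : Measurable (pointSumSkip ψ k) :=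
  Measurable.tsum fun i => measurable_point hψ (skipAt k i)

/-- The gaps, translated to start at the previous arrival, tile the positive half-line. -/
lemma lintegral_Ioi_eq_tsum {e : ℕ → ℝ} (he : ∀ i, 0 < e i)
    (ht : Filter.Tendsto (fun n => ∑ j ∈ Finset.range n, e j) Filter.atTop Filter.atTop)
    (g : ℝ → ℝ≥0∞) :
    ∑' k, ∫⁻ u in Set.Ioc 0 (e k), g (∑ j ∈ Finset.range k, e j + u) = ∫⁻ t in Set.Ioi 0, g t := by
  set S : ℕ → ℝ := fun n => ∑ j ∈ Finset.range n, e j with hS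
  have hmono : Monotone S := monotone_nat_of_le_succ fun n => by
    simp only [hS, Finset.sum_range_succ]; linarith [he n]
  have hU : ⋃ k, Set.Ioc (S k) (S (k + 1)) = Set.Ioi 0 := by
    have := iUnion_Ioc_map_succ_eq_Ioi (f := S) (fun a => hmono bot_le)
      (Filter.not_bddAbove_of_tendsto_atTop ht)
    simpa [hS] using this
  have hdisj : Pairwise (Function.onFun Disjoint fun k => Set.Ioc (S k) (S (k + 1))) :=
    hmono.pairwise_disjoint_on_Ioc_succ
  rw [← hU, lintegral_iUnion (fun _ => measurableSet_Ioc) hdisj]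
  refine tsum_congr fun k => ?_
  rw [← lintegral_indicator measurableSet_Ioc, ← lintegral_indicator measurableSet_Ioc]
  conv_rhs => rw [← lintegral_add_left_eq_self _ (S k)]
  refine lintegral_congr fun u => ?_
  simp only [Set.indicator, Set.mem_Ioc, hS, Finset.sum_range_succ]
  congr 1
  simp

/-- **Mecke's formula** for the marked Poisson process. -/
lemma lintegral_tsum_pointSumSkip (Q : Measure 𝒵) [IsProbabilityMeasure Q]
    {φ : 𝒵 → ℝ → ℝ≥0∞ → ℝ≥0∞} (hφ : Measurable fun p : (𝒵 × ℝ) × ℝ≥0∞ => φ p.1.1 p.1.2 p.2)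
    {ψ : 𝒵 → ℝ → ℝ≥0∞} (hψ : Measurable (Function.uncurry ψ)) :
    ∫⁻ ω, ∑' k, φ (ω.1 k) (arrivalTime ω.2 k) (pointSumSkip ψ k ω) ∂randomnessLaw Q =
      ∫⁻ z, ∫⁻ ω, (∫⁻ t in Set.Ioi 0, φ z t (pointSum ψ ω)) ∂randomnessLaw Q ∂Q := by
  have hterm (k : ℕ) : Measurable fun ω : (ℕ → 𝒵) × (ℕ → ℝ) =>
      φ (ω.1 k) (arrivalTime ω.2 k) (pointSumSkip ψ k ω) :=
    hφ.comp (f := fun ω : (ℕ → 𝒵) × (ℕ → ℝ) =>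
      ((ω.1 k, arrivalTime ω.2 k), pointSumSkip ψ k ω))
      ((((measurable_pi_apply k).comp measurable_fst).prodMk
        ((measurable_arrivalTime k).comp measurable_snd)).prodMk (measurable_pointSumSkip hψ k))
  have hW := measurable_pointSum hψ
  have hG (k : ℕ) : Measurable fun p : (𝒵 × ((ℕ → 𝒵) × (ℕ → ℝ))) × ℝ =>
      {p : (𝒵 × ((ℕ → 𝒵) × (ℕ → ℝ))) × ℝ | 0 < p.2 ∧ p.2 ≤ p.1.2.2 k}.indicator
        (fun p => φ p.1.1 (∑ j ∈ Finset.range k, p.1.2.2 j + p.2) (pointSum ψ p.1.2)) p := by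
    refine Measurable.indicator ?_ ?_
    · refine hφ.comp (f := fun p : (𝒵 × ((ℕ → 𝒵) × (ℕ → ℝ))) × ℝ =>
        ((p.1.1, ∑ j ∈ Finset.range k, p.1.2.2 j + p.2), pointSum ψ p.1.2)) ?_
      refine Measurable.prodMk (by fun_prop) (hW.comp (by fun_prop))
    · exact (measurableSet_lt measurable_const measurable_snd).inter
        (measurableSet_le measurable_snd (by fun_prop))
  have hR (k : ℕ) : Measurable fun p : 𝒵 × ((ℕ → 𝒵) × (ℕ → ℝ)) =>
      ∫⁻ u in Set.Ioc 0 (p.2.2 k),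
        φ p.1 (∑ j ∈ Finset.range k, p.2.2 j + u) (pointSum ψ p.2) := by
    have := (hG k).lintegral_prod_right' (ν := (volume : Measure ℝ))
    convert this using 2 with p
    rw [← lintegral_indicator measurableSet_Ioc]
    rfl
  -- Pull out mark `k` and arrival `k`. What remains is again distributed as `randomnessLaw Q`, and
  -- the sum over the other points becomes its full `pointSum`.
  have hk (k : ℕ) :
      ∫⁻ ω, φ (ω.1 k) (arrivalTime ω.2 k) (pointSumSkip ψ k ω) ∂randomnessLaw Q =
        ∫⁻ z, ∫⁻ ω, (∫⁻ u in Set.Ioc 0 (ω.2 k),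
          φ z (∑ j ∈ Finset.range k, ω.2 j + u) (pointSum ψ ω)) ∂randomnessLaw Q ∂Q := by
    rw [randomnessLaw, lintegral_prod _ (hterm k).aemeasurable,
      lintegral_infinitePi_eq_insertAt Q k (hterm k).lintegral_prod_right']
    refine lintegral_congr fun z => ?_
    rw [lintegral_prod]
    · refine lintegral_congr fun Z => ?_
      rw [lintegral_infinitePi_expMeasure_eq_splitAt k]
      · refine lintegral_congr fun e => lintegral_congr fun u => ?_
        simp only [insertAt_self, arrivalTime_splitAt_self, pointSumSkip, insertAt_skipAt,
          arrivalTime_splitAt_skipAt, pointSum]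
      · exact (hterm k).comp measurable_prodMk_left
    · exact ((hR k).comp measurable_prodMk_left).aemeasurable
  rw [lintegral_tsum fun k => (hterm k).aemeasurable, tsum_congr hk, ← lintegral_tsum]
  · refine lintegral_congr fun z => ?_
    rw [← lintegral_tsum]
    -- Summing over `k` glues the integrals over single gaps into one over all times.
    · have hae : ∀ᵐ ω ∂randomnessLaw Q, (∀ i, 0 < ω.2 i) ∧
          Filter.Tendsto (fun n => ∑ j ∈ Finset.range n, ω.2 j) Filter.atTop Filter.atTop :=
        Measure.quasiMeasurePreserving_snd.ae (ae_forall_pos.and ae_tendsto_sum_atTop)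
      refine lintegral_congr_ae ?_
      filter_upwards [hae] with ω hω
      exact lintegral_Ioi_eq_tsum hω.1 hω.2 fun t => φ z t (pointSum ψ ω)
    · exact fun k => ((hR k).comp measurable_prodMk_left).aemeasurable
  · exact fun k => (hR k).lintegral_prod_right'.aemeasurable

end Mecke

/-! ### Rescaling time. -/

section Scaling

lemma lintegral_Ioi_comp_mul_left {r : ℝ} (hr : 0 < r) {G : ℝ → ℝ≥0∞} (hG : Measurable G) :
    ∫⁻ t in Set.Ioi 0, G t = ENNReal.ofReal r * ∫⁻ s in Set.Ioi 0, G (r * s) := by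
  have h1 : ENNReal.ofReal r * ENNReal.ofReal |r⁻¹| = 1 := by
    rw [← ENNReal.ofReal_mul hr.le, abs_of_pos (inv_pos.2 hr), mul_inv_cancel₀ hr.ne',
      ENNReal.ofReal_one]
  rw [← lintegral_indicator measurableSet_Ioi, ← lintegral_indicator measurableSet_Ioi]
  have h2 : ∫⁻ s, (Set.Ioi 0).indicator (fun s => G (r * s)) s =
      ∫⁻ t, (Set.Ioi 0).indicator G t ∂(volume.map (r * ·)) := by
    rw [lintegral_map (hG.indicator measurableSet_Ioi) (measurable_const_mul r)]
    refine lintegral_congr fun s => ?_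
    simp [Set.indicator, hr]
  rw [h2, Real.map_volume_mul_left hr.ne', lintegral_smul_measure, smul_eq_mul, ← mul_assoc, h1,
    one_mul]

/-- Substituting `t = c s` turns the intensity into a linear prefactor. The condition `χ 0 = 0`
covers `c = 0`. -/
lemma lintegral_Ioi_comp_div {c : ℝ≥0∞} (hc : c ≠ ∞) {χ : ℝ≥0∞ → ℝ≥0∞} (hχ : Measurable χ)
    (h0 : χ 0 = 0) :
    ∫⁻ t in Set.Ioi 0, χ (c / ENNReal.ofReal t) =
      c * ∫⁻ s in Set.Ioi 0, χ (1 / ENNReal.ofReal s) := by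
  rcases eq_or_ne c 0 with rfl | hc0
  · simp [h0]
  have hr : 0 < c.toReal := ENNReal.toReal_pos hc0 hc
  rw [lintegral_Ioi_comp_mul_left hr (G := fun t => χ (c / ENNReal.ofReal t)) (by fun_prop),
    ENNReal.ofReal_toReal hc]
  congr 1
  refine setLIntegral_congr_fun measurableSet_Ioi fun s hs => ?_
  have hs' : ENNReal.ofReal s ≠ 0 := by simpa using hs
  rw [ENNReal.ofReal_mul hr.le, ENNReal.ofReal_toReal hc]
  nth_rw 1 [← mul_one c]
  rw [ENNReal.mul_div_mul_left _ _ hc0 hc]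

/-- The truncation controls the integrand near `0`, and `1 < α` controls it at infinity. -/
lemma lintegral_Ioi_min_one_rpow_ne_top {α : ℝ} (hα : 1 < α) :
    ∫⁻ s in Set.Ioi (0 : ℝ), min 1 ((1 / ENNReal.ofReal s) ^ α) ≠ ∞ := by
  have hU : Set.Ioi (0 : ℝ) = Set.Ioc 0 1 ∪ Set.Ioi 1 := (Set.Ioc_union_Ioi_eq_Ioi zero_le_one).symm
  rw [hU]
  refine ne_top_of_le_ne_top ?_ (lintegral_union_le _ _ _)
  refine ENNReal.add_ne_top.2 ⟨?_, ?_⟩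
  · refine ne_top_of_le_ne_top ?_ (lintegral_mono fun s => min_le_left _ _)
    simp
  · have hint := (integrableOn_Ioi_rpow_of_lt (by linarith : -α < -1) one_pos).lintegral_lt_top
    refine ne_top_of_le_ne_top hint.ne ?_
    refine setLIntegral_mono' measurableSet_Ioi fun s hs => (min_le_right _ _).trans ?_
    have hs' : (0 : ℝ) < s := one_pos.trans hs
    rw [one_div, ← ENNReal.ofReal_inv_of_pos hs',
      ENNReal.ofReal_rpow_of_pos (inv_pos.2 hs'), Real.inv_rpow hs'.le, Real.rpow_neg hs'.le]

end Scaling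

/-! ### Inequalities for extended nonnegative sums and quotients. -/

section Sums

/-- Only finitely many terms can reach the truncation level. This is needed because `t ^ (-α)` is
not integrable near `0`, so finiteness of the total weight cannot be read off from its expectation.
-/
lemma tsum_ne_top_of_tsum_min_one_ne_top {x : ℕ → ℝ≥0∞} (hx : ∀ i, x i ≠ ∞)
    (h : ∑' i, min 1 (x i) ≠ ∞) : ∑' i, x i ≠ ∞ := by
  have h1 : ∀ᶠ i in Filter.atTop, min 1 (x i) < 1 :=
    (ENNReal.tendsto_atTop_zero_of_tsum_ne_top h).eventually_lt_const one_pos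
  obtain ⟨n, hn⟩ := Filter.eventually_atTop.1 h1
  have hle : ∀ i, n ≤ i → x i ≤ min 1 (x i) := fun i hi => by
    rcases min_lt_iff.1 (hn i hi) with h | h
    · exact absurd h (lt_irrefl _)
    · exact le_min h.le le_rfl
  rw [← Summable.sum_add_tsum_nat_add' (f := x) (k := n) ENNReal.summable]
  refine ENNReal.add_ne_top.2 ⟨ENNReal.sum_ne_top.2 fun i _ => hx i, ?_⟩
  refine ne_top_of_le_ne_top h ?_
  calc ∑' i, x (i + n) ≤ ∑' i, min 1 (x (i + n)) :=
        ENNReal.tsum_le_tsum fun i => hle _ (Nat.le_add_left n i)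
    _ ≤ ∑' i, min 1 (x i) :=
        ENNReal.tsum_comp_le_tsum_of_injective (add_left_injective n) fun i => min 1 (x i)

/-- Subtraction-free form of the coupling bound `a(s) - c(s) ≤ a(ℕ) - b(ℕ)` for a common minorant
`b`: terms in `s` use `b ≤ c`, the others `b ≤ a`. -/
lemma tsum_indicator_add_tsum_le {a b c : ℕ → ℝ≥0∞} (s : Set ℕ) (hba : ∀ k, b k ≤ a k)
    (hbc : ∀ k, b k ≤ c k) :
    ∑' k, s.indicator a k + ∑' k, b k ≤ ∑' k, s.indicator c k + ∑' k, a k := by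
  rw [← ENNReal.tsum_add, ← ENNReal.tsum_add]
  refine ENNReal.tsum_le_tsum fun k => ?_
  by_cases hk : k ∈ s
  · simp only [Set.indicator_of_mem hk]
    rw [add_comm]
    exact add_le_add_left (hbc k) _
  · simp only [Set.indicator_of_notMem hk, zero_add]
    exact hba k

lemma div_add_le_div_add {a b x y : ℝ≥0∞} (hab : a ≤ b) (hxy : x ≤ y) (ha : a ≠ ∞) (hb : b ≠ ∞) :
    a / (a + y) ≤ b / (b + x) := by
  rcases eq_or_ne a 0 with rfl | ha0
  · simp
  have hb0 : b ≠ 0 := fun h => ha0 (le_bot_iff.1 (hab.trans_eq h))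
  have key (c w : ℝ≥0∞) (hc0 : c ≠ 0) (hc : c ≠ ∞) : c / (c + w) = (1 + w / c)⁻¹ := by
    rw [← ENNReal.div_self hc0 hc, ← ENNReal.add_div, ENNReal.inv_div (Or.inl hc) (Or.inl hc0)]
  rw [key a y ha0 ha, key b x hb0 hb]
  gcongr

end Sums

/-! ### Weights of the points and their almost sure summability. -/

section Score

variable {𝒵 : Type*}

/-- The weight `(f z / t) ^ α` of a point at time `t` with mark `z`. -/
noncomputable def score (α : ℝ) (f : 𝒵 → ℝ≥0∞) (z : 𝒵) (t : ℝ) : ℝ≥0∞ :=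
  (f z / ENNReal.ofReal t) ^ α

lemma score_mono {α : ℝ} (hα : 0 ≤ α) {f g : 𝒵 → ℝ≥0∞} {z : 𝒵} (h : f z ≤ g z) (t : ℝ) :
    score α f z t ≤ score α g z t :=
  ENNReal.rpow_le_rpow (ENNReal.div_le_div_right h _) hα

lemma score_const_mul {α : ℝ} (hα : 0 ≤ α) (c : ℝ≥0∞) (f : 𝒵 → ℝ≥0∞) (z : 𝒵) (t : ℝ) :
    score α (fun z => c * f z) z t = c ^ α * score α f z t := by
  rw [score, mul_div_assoc, ENNReal.mul_rpow_of_nonneg _ _ hα, score]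

lemma score_ne_top {α : ℝ} (hα : 0 ≤ α) {f : 𝒵 → ℝ≥0∞} {z : 𝒵} (h : f z ≠ ∞) {t : ℝ}
    (ht : 0 < t) : score α f z t ≠ ∞ :=
  ENNReal.rpow_ne_top_of_nonneg hα (ENNReal.div_ne_top h (by simpa using ht))

lemma score_ne_zero {α : ℝ} {f : 𝒵 → ℝ≥0∞} {z : 𝒵} (h : f z ≠ 0) (h' : f z ≠ ∞) {t : ℝ}
    (ht : 0 < t) : score α f z t ≠ 0 := by
  refine (ENNReal.rpow_pos ?_ ?_).ne'
  · exact ENNReal.div_pos h ENNReal.ofReal_ne_top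
  · exact ENNReal.div_ne_top h' (by simpa using ht)

variable [MeasurableSpace 𝒵]

lemma measurable_score (α : ℝ) {f : 𝒵 → ℝ≥0∞} (hf : Measurable f) :
    Measurable (Function.uncurry (score α f)) := by
  unfold score Function.uncurry
  fun_prop

/-- At a positive time the separate case of vanishing density is absorbed: both `∞ ^ (-α)` and `(0 /
t) ^ α` are `0`. -/
lemma weight_eq_score {α : ℝ} (hα : 0 < α) (Q P : Measure 𝒵) (ω : (ℕ → 𝒵) × (ℕ → ℝ)) (i : ℕ)
    (hT : 0 < arrivalTime ω.2 i) :
    weight α Q P ω i = score α (P.rnDeriv Q) (ω.1 i) (arrivalTime ω.2 i) := by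
  have hT0 : ENNReal.ofReal (arrivalTime ω.2 i) ≠ 0 := by simpa using hT
  unfold weight scaledTime score
  split_ifs with h
  · rw [h]
    simp [hα]
  · rw [ENNReal.rpow_neg, ← ENNReal.inv_rpow,
      ENNReal.mul_inv (Or.inl hT0) (Or.inl ENNReal.ofReal_ne_top), inv_inv, mul_comm,
      ← div_eq_mul_inv]

lemma ae_arrivalTime_pos (Q : Measure 𝒵) [IsProbabilityMeasure Q] :
    ∀ᵐ ω ∂randomnessLaw Q, ∀ i, 0 < arrivalTime ω.2 i := by
  have h : ∀ᵐ ω ∂randomnessLaw Q, ∀ i, 0 < ω.2 i :=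
    Measure.quasiMeasurePreserving_snd.ae ae_forall_pos
  filter_upwards [h] with ω hω i
  exact Finset.sum_pos (fun j _ => hω j) ⟨0, by simp⟩

lemma ae_forall_mark {Q : Measure 𝒵} [IsProbabilityMeasure Q] {p : 𝒵 → Prop}
    (hp : ∀ᵐ z ∂Q, p z) : ∀ᵐ ω ∂randomnessLaw Q, ∀ i, p (ω.1 i) := by
  have h : ∀ᵐ x ∂(Measure.infinitePi fun _ : ℕ => Q), ∀ i, p (x i) := by
    rw [ae_all_iff]
    exact fun i => (measurePreserving_eval_infinitePi (fun _ : ℕ => Q) i).quasiMeasurePreserving.ae hp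
  exact Measure.quasiMeasurePreserving_fst.ae h

/-- The total weight is almost surely finite. -/
lemma ae_pointSum_score_ne_top {Q : Measure 𝒵} [IsProbabilityMeasure Q] {α : ℝ} (hα : 1 < α)
    {f : 𝒵 → ℝ≥0∞} (hf : Measurable f) (hfi : ∫⁻ z, f z ∂Q ≠ ∞) :
    ∀ᵐ ω ∂randomnessLaw Q, pointSum (score α f) ω ≠ ∞ := by
  have hα0 : 0 < α := one_pos.trans hα
  have hfin : ∀ᵐ z ∂Q, f z ≠ ∞ := (ae_lt_top hf hfi).mono fun _ h => h.ne
  have hs := measurable_score α hf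
  have hmin : Measurable (Function.uncurry fun z t => min 1 (score α f z t)) :=
    measurable_const.min hs
  -- Mecke's formula with no dependence on the other points, hence the dummy `ψ = 0`.
  have hE : ∫⁻ ω, ∑' k, min 1 (score α f (ω.1 k) (arrivalTime ω.2 k)) ∂randomnessLaw Q ≠ ∞ := by
    rw [lintegral_tsum_pointSumSkip Q (φ := fun z t _ => min 1 (score α f z t))
      (ψ := fun _ _ => 0) (hmin.comp measurable_fst) measurable_const]
    have h1 : ∀ᵐ z ∂Q, ∫⁻ _ω, (∫⁻ t in Set.Ioi 0, min 1 (score α f z t)) ∂randomnessLaw Q =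
        f z * ∫⁻ s in Set.Ioi (0 : ℝ), min 1 ((1 / ENNReal.ofReal s) ^ α) := by
      filter_upwards [hfin] with z hz
      rw [lintegral_const, measure_univ, mul_one]
      exact lintegral_Ioi_comp_div hz (χ := fun y => min 1 (y ^ α)) (by fun_prop) (by simp [hα0])
    rw [lintegral_congr_ae h1, lintegral_mul_const _ hf]
    exact ENNReal.mul_ne_top hfi (lintegral_Ioi_min_one_rpow_ne_top hα)
  have hlt := ae_lt_top (Measurable.tsum fun k => measurable_point hmin k) hE
  filter_upwards [hlt, ae_arrivalTime_pos Q, ae_forall_mark hfin] with ω h1 h2 h3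
  exact tsum_ne_top_of_tsum_min_one_ne_top (fun i => score_ne_top hα0.le (h3 i) (h2 i)) h1.ne

/-- The total weight is almost surely positive. -/
lemma ae_pointSum_score_ne_zero {Q : Measure 𝒵} [IsProbabilityMeasure Q] {α : ℝ}
    {f : 𝒵 → ℝ≥0∞} (hf : Measurable f) (hfi : ∫⁻ z, f z ∂Q ≠ ∞) (hf0 : ∫⁻ z, f z ∂Q ≠ 0) :
    ∀ᵐ ω ∂randomnessLaw Q, pointSum (score α f) ω ≠ 0 := by
  have hfin : ∀ᵐ z ∂Q, f z ≠ ∞ := (ae_lt_top hf hfi).mono fun _ h => h.ne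
  have hpos : Q {z | f z ≠ 0} ≠ 0 := fun h => hf0 ((lintegral_eq_zero_iff hf).2 h)
  have hex := (Measure.quasiMeasurePreserving_fst (μ := Measure.infinitePi fun _ : ℕ => Q)
    (ν := Measure.infinitePi fun _ : ℕ => expMeasure 1)).ae
    (ae_frequently_mem_infinitePi Q (hf (measurableSet_singleton 0)).compl hpos)
  filter_upwards [hex, ae_arrivalTime_pos Q, ae_forall_mark hfin] with ω h1 h2 h3 h0
  obtain ⟨i, hi⟩ := h1.exists
  exact score_ne_zero hi (h3 i) (h2 i) (ENNReal.tsum_eq_zero.1 h0 i)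

end Score

/-! ### Comparing the choices made with different intensities. -/

section Overlap

variable {𝒵 : Type*}

/-- The probability that the index `k` is chosen with intensity `f`, given the points. -/
noncomputable def choiceProb (α : ℝ) (f : 𝒵 → ℝ≥0∞) (ω : (ℕ → 𝒵) × (ℕ → ℝ)) (k : ℕ) : ℝ≥0∞ :=
  score α f (ω.1 k) (arrivalTime ω.2 k) / pointSum (score α f) ω

/-- The share of the point `k` when it has intensity `m` and the other points have intensity `g`. -/
noncomputable def overlapProb (α : ℝ) (m g : 𝒵 → ℝ≥0∞) (ω : (ℕ → 𝒵) × (ℕ → ℝ)) (k : ℕ) :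
    ℝ≥0∞ :=
  score α m (ω.1 k) (arrivalTime ω.2 k) /
    (score α m (ω.1 k) (arrivalTime ω.2 k) + pointSumSkip (score α g) k ω)

lemma overlapProb_self (α : ℝ) (g : 𝒵 → ℝ≥0∞) (ω : (ℕ → 𝒵) × (ℕ → ℝ)) (k : ℕ) :
    overlapProb α g g ω k = choiceProb α g ω k := by
  rw [overlapProb, ← pointSum_eq_add_pointSumSkip, choiceProb]

lemma overlapProb_le_overlapProb {α : ℝ} (hα : 0 ≤ α) {m g f h : 𝒵 → ℝ≥0∞}
    {ω : (ℕ → 𝒵) × (ℕ → ℝ)} (hT : ∀ i, 0 < arrivalTime ω.2 i) (hmf : ∀ z, m z ≤ f z)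
    (hhg : ∀ z, h z ≤ g z) (hf : ∀ i, f (ω.1 i) ≠ ∞) (k : ℕ) :
    overlapProb α m g ω k ≤ overlapProb α f h ω k :=
  div_add_le_div_add (score_mono hα (hmf _) _)
    (ENNReal.tsum_le_tsum fun _ => score_mono hα (hhg _) _)
    (score_ne_top hα (ne_top_of_le_ne_top (hf k) (hmf _)) (hT k)) (score_ne_top hα (hf k) (hT k))

lemma tsum_choiceProb {α : ℝ} {f : 𝒵 → ℝ≥0∞} {ω : (ℕ → 𝒵) × (ℕ → ℝ)}
    (h0 : pointSum (score α f) ω ≠ 0) (h1 : pointSum (score α f) ω ≠ ∞) :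
    ∑' k, choiceProb α f ω k = 1 := by
  simp only [choiceProb, div_eq_mul_inv, ENNReal.tsum_mul_right]
  exact ENNReal.mul_inv_cancel h0 h1

/-- Intensities within a factor `c` of each other give choice probabilities within a factor
`c ^ α * c ^ α`. -/
lemma choiceProb_le {α : ℝ} (hα : 0 ≤ α) {c : ℝ≥0∞} (hc0 : c ≠ 0) (hc : c ≠ ∞)
    {h g : 𝒵 → ℝ≥0∞} (hhg : ∀ z, h z ≤ c * g z) (hgh : ∀ z, g z ≤ c * h z)
    (ω : (ℕ → 𝒵) × (ℕ → ℝ)) (k : ℕ) :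
    choiceProb α h ω k ≤ c ^ α * c ^ α * choiceProb α g ω k := by
  have hca0 : c ^ α ≠ 0 := (ENNReal.rpow_pos (pos_iff_ne_zero.2 hc0) hc).ne'
  have hca : c ^ α ≠ ∞ := ENNReal.rpow_ne_top_of_nonneg hα hc
  have h1 : score α h (ω.1 k) (arrivalTime ω.2 k) ≤
      c ^ α * score α g (ω.1 k) (arrivalTime ω.2 k) := by
    rw [← score_const_mul hα]
    exact score_mono hα (hhg _) _
  have h2 : pointSum (score α g) ω ≤ c ^ α * pointSum (score α h) ω := by
    rw [pointSum, pointSum, ← ENNReal.tsum_mul_left]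
    refine ENNReal.tsum_le_tsum fun i => ?_
    rw [← score_const_mul hα]
    exact score_mono hα (hgh _) _
  -- The normalization contributes the second factor `c ^ α`.
  have h3 : (pointSum (score α h) ω)⁻¹ ≤ c ^ α * (pointSum (score α g) ω)⁻¹ := by
    have := ENNReal.inv_le_inv.2 h2
    rw [ENNReal.mul_inv (Or.inl hca0) (Or.inl hca)] at this
    calc (pointSum (score α h) ω)⁻¹
        = c ^ α * ((c ^ α)⁻¹ * (pointSum (score α h) ω)⁻¹) := by
          rw [← mul_assoc, ENNReal.mul_inv_cancel hca0 hca, one_mul]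
      _ ≤ _ := by gcongr
  calc choiceProb α h ω k
      ≤ (c ^ α * score α g (ω.1 k) (arrivalTime ω.2 k)) *
        (c ^ α * (pointSum (score α g) ω)⁻¹) := by
        rw [choiceProb, div_eq_mul_inv]
        exact mul_le_mul' h1 h3
    _ = _ := by
        rw [choiceProb, div_eq_mul_inv]
        ring

variable [MeasurableSpace 𝒵]

lemma measurable_overlapProb (α : ℝ) {m g : 𝒵 → ℝ≥0∞} (hm : Measurable m) (hg : Measurable g)
    (k : ℕ) : Measurable fun ω => overlapProb α m g ω k := by
  have h1 := measurable_point (measurable_score α hm) k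
  have h2 := measurable_pointSumSkip (measurable_score α hg) k
  unfold overlapProb
  fun_prop

/-- The expected total overlap is proportional to the mass of the smaller intensity. -/
lemma lintegral_tsum_overlapProb {Q : Measure 𝒵} [IsProbabilityMeasure Q] {α : ℝ} (hα : 0 < α)
    {m g : 𝒵 → ℝ≥0∞} (hm : Measurable m) (hg : Measurable g) (hmi : ∫⁻ z, m z ∂Q ≠ ∞) :
    ∫⁻ ω, ∑' k, overlapProb α m g ω k ∂randomnessLaw Q =
      (∫⁻ z, m z ∂Q) * ∫⁻ ω, (∫⁻ s in Set.Ioi (0 : ℝ), (1 / ENNReal.ofReal s) ^ α /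
        ((1 / ENNReal.ofReal s) ^ α + pointSum (score α g) ω)) ∂randomnessLaw Q := by
  have hmecke := lintegral_tsum_pointSumSkip Q
    (φ := fun z t w => score α m z t / (score α m z t + w)) (ψ := score α g) (by
      have h1 : Measurable fun p : (𝒵 × ℝ) × ℝ≥0∞ => score α m p.1.1 p.1.2 :=
        (measurable_score α hm).comp measurable_fst
      fun_prop) (measurable_score α hg)
  refine hmecke.trans ?_
  rw [← lintegral_mul_const _ hm]
  refine lintegral_congr_ae ?_
  filter_upwards [ae_lt_top hm hmi] with z hz
  rw [← lintegral_const_mul' _ _ hz.ne]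
  refine lintegral_congr fun ω => ?_
  exact lintegral_Ioi_comp_div hz.ne
    (χ := fun y => y ^ α / (y ^ α + pointSum (score α g) ω)) (by fun_prop) (by simp [hα])

/-- Changing the intensity by `η` in `L¹` changes the law of the choice by at most `η`. -/
lemma lintegral_choiceProb_le_add {Q : Measure 𝒵} [IsProbabilityMeasure Q] {α : ℝ} (hα : 1 < α)
    {f h : 𝒵 → ℝ≥0∞} (hf : Measurable f) (hh : Measurable h) (hf1 : ∫⁻ z, f z ∂Q = 1)
    (hhi : ∫⁻ z, h z ∂Q ≠ ∞) {η : ℝ≥0∞}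
    (hη : ∫⁻ z, max (f z) (h z) ∂Q ≤ ∫⁻ z, min (f z) (h z) ∂Q + η)
    (s : (ℕ → 𝒵) × (ℕ → ℝ) → Set ℕ) :
    ∫⁻ ω, ∑' k, (s ω).indicator (choiceProb α f ω) k ∂randomnessLaw Q ≤
      ∫⁻ ω, ∑' k, (s ω).indicator (choiceProb α h ω) k ∂randomnessLaw Q + η := by
  have hα0 : 0 < α := one_pos.trans hα
  set m : 𝒵 → ℝ≥0∞ := fun z => min (f z) (h z) with hmdef
  set g : 𝒵 → ℝ≥0∞ := fun z => max (f z) (h z) with hgdef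
  have hm : Measurable m := hf.min hh
  have hg : Measurable g := hf.max hh
  have hfi : ∫⁻ z, f z ∂Q ≠ ∞ := by simp [hf1]
  have hgi : ∫⁻ z, g z ∂Q ≠ ∞ := by
    refine ne_top_of_le_ne_top (ENNReal.add_ne_top.2 ⟨hfi, hhi⟩) ?_
    rw [← lintegral_add_left hf]
    exact lintegral_mono fun z => max_le le_self_add le_add_self
  have hg1 : 1 ≤ ∫⁻ z, g z ∂Q := by
    rw [← hf1]
    exact lintegral_mono fun z => le_max_left _ _
  have hmg : ∫⁻ z, m z ∂Q ≤ ∫⁻ z, g z ∂Q :=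
    lintegral_mono fun z => (min_le_left _ _).trans (le_max_left _ _)
  have hmi : ∫⁻ z, m z ∂Q ≠ ∞ := ne_top_of_le_ne_top hgi hmg
  have hBm := lintegral_tsum_overlapProb (Q := Q) hα0 hm hg hmi
  have hBg := lintegral_tsum_overlapProb (Q := Q) hα0 hg hg hgi
  set C : ℝ≥0∞ := ∫⁻ ω, (∫⁻ s in Set.Ioi (0 : ℝ), (1 / ENNReal.ofReal s) ^ α /
        ((1 / ENNReal.ofReal s) ^ α + pointSum (score α g) ω)) ∂randomnessLaw Q with hC
  -- For `m = g` the overlaps are genuine choice probabilities. This determines `C` without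
  -- computing its integral.
  have hBg1 : ∫⁻ ω, ∑' k, overlapProb α g g ω k ∂randomnessLaw Q = 1 := by
    have : ∀ᵐ ω ∂randomnessLaw Q, ∑' k, overlapProb α g g ω k = 1 := by
      filter_upwards [ae_pointSum_score_ne_top hα hg hgi, ae_pointSum_score_ne_zero (α := α) hg hgi
        (one_pos.trans_le hg1).ne'] with ω h1 h2
      simp_rw [overlapProb_self]
      exact tsum_choiceProb h2 h1
    rw [lintegral_congr_ae this]
    simp
  have hC1 : C ≤ 1 := by
    rw [← hBg1, hBg]
    exact le_mul_of_one_le_left zero_le hg1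
  -- The error enters as `η * C`, and `C ≤ 1` because `g` has mass at least one.
  have hB : 1 ≤ ∫⁻ ω, ∑' k, overlapProb α m g ω k ∂randomnessLaw Q + η := by
    rw [hBm]
    calc (1 : ℝ≥0∞) = (∫⁻ z, g z ∂Q) * C := by rw [← hBg, hBg1]
      _ ≤ (∫⁻ z, m z ∂Q + η) * C := by gcongr
      _ ≤ (∫⁻ z, m z ∂Q) * C + η := by
        rw [add_mul]
        gcongr
        exact mul_le_of_le_one_right zero_le hC1
  have hBtop : ∫⁻ ω, ∑' k, overlapProb α m g ω k ∂randomnessLaw Q ≠ ∞ := by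
    refine ne_top_of_le_ne_top ENNReal.one_ne_top ?_
    rw [hBm, ← hBg1, hBg]
    gcongr
  have hBmeas : Measurable fun ω => ∑' k, overlapProb α m g ω k :=
    Measurable.tsum fun k => measurable_overlapProb α hm hg k
  -- The overlap is a common minorant of both choice laws: a share increases with the intensity of
  -- its own point and decreases with that of the others.
  have hpt : ∀ᵐ ω ∂randomnessLaw Q,
      ∑' k, (s ω).indicator (choiceProb α f ω) k + ∑' k, overlapProb α m g ω k ≤
        ∑' k, (s ω).indicator (choiceProb α h ω) k + 1 := by
    filter_upwards [ae_arrivalTime_pos Q, ae_forall_mark (ae_lt_top hf hfi),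
      ae_forall_mark (ae_lt_top hh hhi), ae_pointSum_score_ne_top hα hf hfi,
      ae_pointSum_score_ne_zero (α := α) hf hfi (by simp [hf1])] with ω hT h1 h2 h3 h4
    rw [← tsum_choiceProb h4 h3]
    refine tsum_indicator_add_tsum_le (s ω) (fun k => ?_) fun k => ?_
    · rw [← overlapProb_self]
      exact overlapProb_le_overlapProb hα0.le hT (fun z => min_le_left _ _)
        (fun z => le_max_left _ _) (fun i => (h1 i).ne) k
    · rw [← overlapProb_self]
      exact overlapProb_le_overlapProb hα0.le hT (fun z => min_le_right _ _)
        (fun z => le_max_right _ _) (fun i => (h2 i).ne) k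
  have hint := lintegral_mono_ae hpt
  rw [lintegral_add_right _ hBmeas, lintegral_add_right _ measurable_const, lintegral_const,
    measure_univ, mul_one] at hint
  refine (ENNReal.add_le_add_iff_right hBtop).1 (hint.trans ?_)
  rw [add_assoc, add_comm η]
  gcongr

end Overlap

/-! ### The law of the output, hockey-stick divergence and clamping. -/

section Privacy

variable {𝒵 : Type*} [MeasurableSpace 𝒵]

/-- The total weight is almost surely positive and finite, so the fallback branch of `indexLaw` does
not contribute. -/
lemma pprLaw_apply {α : ℝ} (hα : 1 < α) (Q P : Measure 𝒵) [IsProbabilityMeasure Q]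
    [IsProbabilityMeasure P] (hPQ : P ≪ Q) {S : Set ((ℕ → 𝒵) × ℕ)} (hS : MeasurableSet S) :
    pprLaw α Q P S = ∫⁻ ω, ∑' k, {k | (ω.1, k) ∈ S}.indicator
      (choiceProb α (P.rnDeriv Q) ω) k ∂randomnessLaw Q := by
  have hα0 : 0 < α := one_pos.trans hα
  have hf := Measure.measurable_rnDeriv P Q
  have hf1 : ∫⁻ z, P.rnDeriv Q z ∂Q = 1 := by
    rw [Measure.lintegral_rnDeriv hPQ, measure_univ]
  have hmap : Measurable fun p : ((ℕ → 𝒵) × (ℕ → ℝ)) × ℕ => (p.1.1, p.2) := by fun_prop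
  rw [pprLaw, Measure.map_apply hmap hS, Measure.compProd_apply (hmap hS)]
  refine lintegral_congr_ae ?_
  filter_upwards [ae_arrivalTime_pos Q,
    ae_pointSum_score_ne_top hα hf (by rw [hf1]; exact ENNReal.one_ne_top),
    ae_pointSum_score_ne_zero (α := α) hf (by rw [hf1]; exact ENNReal.one_ne_top)
      (by rw [hf1]; exact one_ne_zero)] with ω hT h1 h2
  have hw (k : ℕ) := weight_eq_score hα0 Q P ω k (hT k)
  have htot : totalWeight α Q P ω = pointSum (score α (P.rnDeriv Q)) ω := tsum_congr hw
  change indexLaw α Q P ω _ = _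
  rw [indexLaw, if_neg (by rw [htot]; tauto), Measure.sum_apply _ (MeasurableSet.of_discrete)]
  refine tsum_congr fun k => ?_
  rw [Measure.smul_apply, Measure.dirac_apply' _ MeasurableSet.of_discrete, hw, htot, smul_eq_mul]
  by_cases hk : (ω.1, k) ∈ S
  · rw [Set.indicator_of_mem (by exact hk), Set.indicator_of_mem (by exact hk)]
    simp [choiceProb]
  · rw [Set.indicator_of_notMem (by exact hk), Set.indicator_of_notMem (by exact hk), mul_zero]

/-- The truncated difference lives on the set where `c * dP'/dQ ≤ dP/dQ`; applying the hypothesis to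
that one set gives the bound. -/
lemma lintegral_rnDeriv_sub_le {Q P P' : Measure 𝒵} [IsProbabilityMeasure Q]
    [IsProbabilityMeasure P] [IsProbabilityMeasure P'] (hPQ : P ≪ Q) (hPQ' : P' ≪ Q)
    {c d : ℝ≥0∞} (hc : c ≠ ∞)
    (h : ∀ S, MeasurableSet S → P S ≤ c * P' S + d) :
    ∫⁻ z, (P.rnDeriv Q z - c * P'.rnDeriv Q z) ∂Q ≤ d := by
  have hf := Measure.measurable_rnDeriv P Q
  have hf' := (Measure.measurable_rnDeriv P' Q).const_mul c
  set S : Set 𝒵 := {z | c * P'.rnDeriv Q z ≤ P.rnDeriv Q z} with hSdef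
  have hS : MeasurableSet S := measurableSet_le hf' hf
  have h1 : ∫⁻ z, (P.rnDeriv Q z - c * P'.rnDeriv Q z) ∂Q =
      ∫⁻ z in S, (P.rnDeriv Q z - c * P'.rnDeriv Q z) ∂Q := by
    rw [← lintegral_indicator hS]
    refine lintegral_congr fun z => ?_
    by_cases hz : z ∈ S
    · rw [Set.indicator_of_mem hz]
    · rw [Set.indicator_of_notMem hz]
      exact tsub_eq_zero_of_le (not_le.1 hz).le
  have hc' : ∫⁻ z in S, c * P'.rnDeriv Q z ∂Q = c * P' S := by
    rw [lintegral_const_mul _ (Measure.measurable_rnDeriv P' Q), Measure.setLIntegral_rnDeriv hPQ']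
  have hfin : ∫⁻ z in S, c * P'.rnDeriv Q z ∂Q ≠ ∞ := by
    rw [hc']
    exact ENNReal.mul_ne_top hc (measure_ne_top _ _)
  rw [h1, lintegral_sub hf' hfin ((ae_restrict_iff' hS).2 (ae_of_all _ fun z hz => hz)), hc',
    Measure.setLIntegral_rnDeriv hPQ]
  exact tsub_le_iff_left.2 (h S hS)

lemma clamp_le {c a b : ℝ≥0∞} (hc1 : 1 ≤ c) : max (min a (c * b)) (c⁻¹ * b) ≤ c * b := by
  refine max_le (min_le_right _ _) ?_
  gcongr
  exact (ENNReal.inv_le_one.2 hc1).trans hc1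

lemma le_mul_clamp {c a b : ℝ≥0∞} (hc1 : 1 ≤ c) (hc : c ≠ ∞) :
    b ≤ c * max (min a (c * b)) (c⁻¹ * b) := by
  calc b = c * (c⁻¹ * b) := by
        rw [← mul_assoc, ENNReal.mul_inv_cancel (one_pos.trans_le hc1).ne' hc, one_mul]
    _ ≤ _ := by gcongr; exact le_max_right _ _

/-- Clamping moves `a` down by `a - c * b` or up by `c⁻¹ * (b - c * a)`. The factor `c⁻¹ ≤ 1` is
dropped. -/
lemma max_clamp_le {c a b : ℝ≥0∞} (hc1 : 1 ≤ c) (hc : c ≠ ∞) :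
    max a (max (min a (c * b)) (c⁻¹ * b)) ≤
      min a (max (min a (c * b)) (c⁻¹ * b)) + ((a - c * b) + (b - c * a)) := by
  have hc0 : c ≠ 0 := (one_pos.trans_le hc1).ne'
  have hinv : c⁻¹ * b ≤ a + (b - c * a) := by
    calc c⁻¹ * b ≤ c⁻¹ * (c * a + (b - c * a)) := by gcongr; exact le_add_tsub
      _ = a + c⁻¹ * (b - c * a) := by
        rw [mul_add, ← mul_assoc, ENNReal.inv_mul_cancel hc0 hc, one_mul]
      _ ≤ _ := by
        gcongr
        exact mul_le_of_le_one_left zero_le (ENNReal.inv_le_one.2 hc1)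
  rcases le_total a (c * b) with hab | hab
  · have h1 : min a (max (min a (c * b)) (c⁻¹ * b)) = a := by
      rw [min_eq_left hab]
      exact min_eq_left (le_max_left _ _)
    rw [h1, min_eq_left hab, tsub_eq_zero_of_le hab, zero_add]
    exact max_le le_self_add (max_le le_self_add hinv)
  · have h2 : max (min a (c * b)) (c⁻¹ * b) = c * b := by
      rw [min_eq_right hab]
      refine max_eq_left ?_
      gcongr
      exact (ENNReal.inv_le_one.2 hc1).trans hc1
    rw [h2, max_eq_left hab, min_eq_right hab, ← add_assoc]
    exact le_add_tsub.trans le_self_add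

end Privacy

end PPR

/-! ### The privacy guarantee. -/

theorem mainTheorem5 {𝒳 𝒵 : Type*} [MeasurableSpace 𝒵]
    (N : 𝒳 → 𝒳 → Prop) (hN : ∀ x x', N x x' → N x' x)
    (P : 𝒳 → Measure 𝒵) (hP : ∀ x, IsProbabilityMeasure (P x))
    (Q : Measure 𝒵) [IsProbabilityMeasure Q] (hPQ : ∀ x, P x ≪ Q)
    (α ε δ : ℝ) (hα : 1 < α) (hε : 0 ≤ ε) (hδ : 0 ≤ δ)
    (hDP : PPR.IsDP N P ε δ) :
    PPR.IsDP N (fun x => PPR.pprLaw α Q (P x)) (2 * α * ε) (2 * δ) := by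
  intro x x' hxx' S hS
  have hα0 : 0 < α := one_pos.trans hα
  have := hP x
  have := hP x'
  set c : ℝ≥0∞ := ENNReal.ofReal (Real.exp ε) with hcdef
  have hc : c ≠ ∞ := ENNReal.ofReal_ne_top
  have hc1 : 1 ≤ c := by
    rw [hcdef, ENNReal.one_le_ofReal]
    exact Real.one_le_exp hε
  have hc0 : c ≠ 0 := (one_pos.trans_le hc1).ne'
  set f := (P x).rnDeriv Q with hfdef
  set f' := (P x').rnDeriv Q with hfdef'
  have hf : Measurable f := Measure.measurable_rnDeriv _ _
  have hf' : Measurable f' := Measure.measurable_rnDeriv _ _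
  have hf1 : ∫⁻ z, f z ∂Q = 1 := by rw [Measure.lintegral_rnDeriv (hPQ x), measure_univ]
  have hf1' : ∫⁻ z, f' z ∂Q = 1 := by rw [Measure.lintegral_rnDeriv (hPQ x'), measure_univ]
  set h : 𝒵 → ℝ≥0∞ := fun z => max (min (f z) (c * f' z)) (c⁻¹ * f' z) with hhdef
  have hh : Measurable h := by fun_prop
  have hle (z : 𝒵) : h z ≤ c * f' z := PPR.clamp_le hc1
  have hge (z : 𝒵) : f' z ≤ c * h z := PPR.le_mul_clamp hc1 hc
  have hhi : ∫⁻ z, h z ∂Q ≠ ∞ := by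
    refine ne_top_of_le_ne_top ?_ (lintegral_mono hle)
    rw [lintegral_const_mul _ hf', hf1', mul_one]
    exact hc
  have hη : ∫⁻ z, max (f z) (h z) ∂Q ≤ ∫⁻ z, min (f z) (h z) ∂Q + ENNReal.ofReal (2 * δ) := by
    calc ∫⁻ z, max (f z) (h z) ∂Q
        ≤ ∫⁻ z, (min (f z) (h z) + ((f z - c * f' z) + (f' z - c * f z))) ∂Q :=
          lintegral_mono fun z => PPR.max_clamp_le hc1 hc
      _ = ∫⁻ z, min (f z) (h z) ∂Q +
          (∫⁻ z, (f z - c * f' z) ∂Q + ∫⁻ z, (f' z - c * f z) ∂Q) := by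
          rw [lintegral_add_left (hf.min hh),
            lintegral_add_left (by fun_prop : Measurable fun z => f z - c * f' z)]
      _ ≤ _ := by
          rw [two_mul, ENNReal.ofReal_add hδ hδ]
          gcongr
          · exact PPR.lintegral_rnDeriv_sub_le (hPQ x) (hPQ x') hc (hDP x x' hxx')
          -- Upward clamping is paid for by privacy in the reverse direction, hence the symmetry of
          -- `N` and the second `δ`.
          · exact PPR.lintegral_rnDeriv_sub_le (hPQ x') (hPQ x) hc (hDP x' x (hN x x' hxx'))
  have hpow : ENNReal.ofReal (Real.exp (2 * α * ε)) = c ^ α * c ^ α := by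
    rw [hcdef, ENNReal.ofReal_rpow_of_pos (Real.exp_pos ε), ← Real.exp_mul,
      ← ENNReal.ofReal_mul (Real.exp_pos _).le, ← Real.exp_add]
    ring_nf
  have hcc : c ^ α * c ^ α ≠ ∞ := hpow ▸ ENNReal.ofReal_ne_top
  simp only
  rw [PPR.pprLaw_apply hα Q (P x) (hPQ x) hS, PPR.pprLaw_apply hα Q (P x') (hPQ x') hS, hpow]
  -- Replace `f` by `h` at additive cost `2 * δ`; what is left is the pointwise comparison of `h`
  -- with `f'`.
  refine (PPR.lintegral_choiceProb_le_add hα hf hh hf1 hhi hη _).trans ?_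
  gcongr
  rw [← lintegral_const_mul' _ _ hcc]
  refine lintegral_mono fun ω => ?_
  simp only
  rw [← ENNReal.tsum_mul_left]
  refine ENNReal.tsum_le_tsum fun k => ?_
  by_cases hk : k ∈ {k | (ω.1, k) ∈ S}
  · rw [Set.indicator_of_mem hk, Set.indicator_of_mem hk]
    exact PPR.choiceProb_le hα0.le hc0 hc hle hge ω k
  · rw [Set.indicator_of_notMem hk]
    exact zero_le
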